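/- A partially-commutative grammar over a finite alphabet $\Sigma$ consists of a finite set $V$ of non-terminals with an initial symbol $S\in V$, a finite set of productions of the form $X \xrightarrow{a} \alpha$ with $X\in V$, $a\in\Sigma$, $\alpha\in V^*$, and a symmetric irreflexive independence relation $I\subseteq V\times V$. Its dependence relation is $D=(V\times V)\setminus I$. Configurations are words in $V^*$, and there are two kinds of steps: production steps $X\beta \xrightarrow{a} \alpha\beta$ for a production $X\xrightarrow{a}\alpha$ and $\beta\in V^*$, and swap steps $\alpha XY\beta \to \alpha YX\beta$ for $(X,Y)\in I$ and $\alpha,\beta\in V^*$. The language generated by the grammar is the set of all words $w\in\Sigma^*$ such that some finite sequence of steps leads from the configuration $S$ to the empty configuration and the letters of its production steps, in order, form $w$. The class trPCCFL consists of the languages generated by partially-commutative grammars whose dependence relation $D$ is transitive. The class trPCCFL is not closed under concatenation: it is not true that for every finite alphabet $\Sigma$ and all languages $L,K\subseteq\Sigma^*$ in trPCCFL the language $LK$ is in trPCCFL. Specifically, let $$L_1=\{w\in\{a,b,c,d\}^* : \#_a(w)=\#_b(w)=\#_c(w)\ge 1,\ \#_d(w)=0\},\qquad L_2=\{d\},$$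 where $\#_x(w)$ is the number of occurrences of the letter $x$ in $w$. Then $L_1$ and $L_2$ belong to trPCCFL, but $L_1L_2$ does not. -/

import Mathlib

/-- A Greibach grammar with finitely many non-terminals and finitely many productions
`X →[a] α` (stored as triples `(X, a, α)`), equipped with a symmetric and irreflexive
independence relation on its non-terminals. -/
structure PCGrammar (T : Type) where
  /-- the non-terminal symbols -/
  NT : Type
  finite_NT : Finite NT
  /-- the initial non-terminal -/
  initial : NT
  /-- the productions -/
  prods : Set (NT × T × List NT)
  finite_prods : prods.Finite
  /-- the independence relation -/
  Indep : NT → NT → Prop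
  indep_symm : ∀ X Y, Indep X Y → Indep Y X
  indep_irrefl : ∀ X, ¬ Indep X X

namespace PCGrammar

variable {T : Type}

/-- The dependence relation: the complement of independence. -/
def Dep (G : PCGrammar T) (X Y : G.NT) : Prop := ¬ G.Indep X Y

/-- A production step `X β →[a] α β`, for a production `X →[a] α`. Only the first symbol of a
configuration is rewritten. -/
inductive ProdStep (G : PCGrammar T) : List G.NT → T → List G.NT → Prop
  | mk (X : G.NT) (a : T) (α β : List G.NT) (h : (X, a, α) ∈ G.prods) :
      ProdStep G (X :: β) a (α ++ β)

/-- A swap step `α X Y β → α Y X β`, for independent `X` and `Y`. -/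
inductive SwapStep (G : PCGrammar T) : List G.NT → List G.NT → Prop
  | mk (α : List G.NT) (X Y : G.NT) (β : List G.NT) (h : G.Indep X Y) :
      SwapStep G (α ++ X :: Y :: β) (α ++ Y :: X :: β)

/-- `G.Derives α w β`: a finite sequence of production and swap steps leads from the
configuration `α` to the configuration `β`, and the letters of its production steps, in order,
form the word `w`. -/
inductive Derives (G : PCGrammar T) : List G.NT → List T → List G.NT → Prop
  | nil (α : List G.NT) : Derives G α [] α
  | prod {α β γ : List G.NT} {a : T} {w : List T} :
      G.ProdStep α a β → Derives G β w γ → Derives G α (a :: w) γ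
  | swap {α β γ : List G.NT} {w : List T} :
      G.SwapStep α β → Derives G β w γ → Derives G α w γ

/-- The language generated by the grammar: all words `w` for which some derivation from the
initial non-terminal to the empty configuration defines `w`. -/
def language (G : PCGrammar T) : Language T := {w | G.Derives [G.initial] w []}

/-- Transitivity of the dependence relation. -/
def TransitiveDep (G : PCGrammar T) : Prop :=
  ∀ X Y Z : G.NT, G.Dep X Y → G.Dep Y Z → G.Dep X Z

end PCGrammar

/-- The class trPCCFL: languages generated by a partially-commutative Greibach grammar whose
dependence relation is transitive. -/
def IsTrPCCFL {T : Type} (L : Language T) : Prop :=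
  ∃ G : PCGrammar T, G.TransitiveDep ∧ G.language = L

/-- The alphabet `{a, b, c, d}`. -/
inductive Letter
  | a | b | c | d
  deriving DecidableEq

instance : Fintype Letter :=
  ⟨{Letter.a, Letter.b, Letter.c, Letter.d}, by intro x; cases x <;> simp⟩

/-- The words over `{a, b, c, d}` with equally many, and at least one, `a`, `b` and `c`,
and without `d`. -/
def langABC : Language Letter :=
  {w | w.count Letter.a = w.count Letter.b ∧ w.count Letter.b = w.count Letter.c ∧
    1 ≤ w.count Letter.a ∧ w.count Letter.d = 0}

/-! Every word of $L_1L_2$ has its only $d$ at the end. When $D$ is transitive it is an equivalence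
relation, and if an independent pair occurred in a configuration on the way to acceptance, two
different symbols could each be consumed last. Both would have to produce the $d$, which is absurd
(`not_indep_of_endMarked`). Hence accepting derivations contain no swaps (`Derives.leftDerives`) and
$L_1L_2$ would be context-free. A pumping-style exchange excludes this: in $a^nb^nc^nd$ some
non-terminal derives a factor $u$ of intermediate length (`LeftDerives.exists_factor`), and
replacing $u$ by a short word of the same non-terminal upsets the letter counts. -/

namespace PCGrammar

variable {T : Type} {G : PCGrammar T}

/-! ### Derivations and productive symbols -/

lemma Derives.trans {α β γ : List G.NT} {u v : List T} (h : G.Derives α u β)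
    (h' : G.Derives β v γ) : G.Derives α (u ++ v) γ := by
  induction h with
  | nil => exact h'
  | prod hs _ ih => exact .prod hs (ih h')
  | swap hs _ ih => exact .swap hs (ih h')

lemma Derives.append_right {α β : List G.NT} {u : List T} (h : G.Derives α u β)
    (γ : List G.NT) : G.Derives (α ++ γ) u (β ++ γ) := by
  induction h with
  | nil => exact .nil _
  | @prod _ _ _ a _ hs _ ih =>
    obtain ⟨X, _, α, β, hp⟩ := hs
    refine .prod (.mk X a α (β ++ γ) hp) ?_
    simpa using ih
  | swap hs _ ih =>
    obtain ⟨α, X, Y, β, hI⟩ := hs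
    have := SwapStep.mk (G := G) α X Y (β ++ γ) hI
    exact .swap (by simpa using this) (by simpa using ih)

/-- Consuming a prefix of a configuration and then the rest. -/
lemma Derives.append_nil {α β : List G.NT} {u v : List T} (h : G.Derives α u [])
    (h' : G.Derives β v []) : G.Derives (α ++ β) (u ++ v) [] :=
  (by simpa using h.append_right β : G.Derives (α ++ β) u β).trans h'

/-- A non-terminal that derives some word. -/
def Productive (G : PCGrammar T) (X : G.NT) : Prop := ∃ w, G.Derives [X] w []

lemma exists_derives_of_forall_productive {α : List G.NT} (h : ∀ X ∈ α, G.Productive X) :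
    ∃ w, G.Derives α w [] := by
  induction α with
  | nil => exact ⟨[], .nil _⟩
  | cons X α ih =>
    obtain ⟨u, hu⟩ := h X (by simp)
    obtain ⟨v, hv⟩ := ih fun Y hY => h Y (by simp [hY])
    exact ⟨u ++ v, hu.append_nil hv⟩

lemma Derives.productive {α β : List G.NT} {w : List T} (h : G.Derives α w β) (hβ : β = []) :
    ∀ X ∈ α, G.Productive X := by
  induction h with
  | nil => simp [hβ]
  | @prod _ _ _ a _ hs _ ih =>
    obtain ⟨X, _, α, β, hp⟩ := hs
    have ih := ih hβ
    intro Y hY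
    rcases List.mem_cons.1 hY with rfl | hY
    · obtain ⟨v, hv⟩ := exists_derives_of_forall_productive (G := G) (α := α)
        fun Z hZ => ih Z (by simp [hZ])
      exact ⟨a :: v, .prod (.mk Y a α [] hp) (by simpa using hv)⟩
    · exact ih Y (by simp [hY])
  | swap hs _ ih =>
    obtain ⟨α, X, Y, β, hI⟩ := hs
    intro Z hZ
    apply ih hβ Z
    simp only [List.mem_append, List.mem_cons] at hZ ⊢
    tauto

/-- In Greibach form each production emits a letter, and swaps never shorten a configuration. -/
lemma Derives.ne_nil {α : List G.NT} {w : List T} (h : G.Derives α w []) (hα : α ≠ []) :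
    w ≠ [] := by
  generalize hβ : ([] : List G.NT) = β at h
  induction h with
  | nil => exact absurd hβ.symm hα
  | prod => simp
  | swap hs _ ih =>
    obtain ⟨α, X, Y, β, hI⟩ := hs
    exact ih (by simp) hβ

/-- A non-terminal may be moved to the right past a word of independent non-terminals. -/
lemma Derives.of_move {W : G.NT} {β γ δ : List G.NT} {w : List T}
    (hW : ∀ V ∈ β, G.Indep W V) (α : List G.NT)
    (h : G.Derives (α ++ β ++ W :: γ) w δ) : G.Derives (α ++ W :: β ++ γ) w δ := by
  induction β generalizing α with
  | nil => simpa using h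
  | cons V β ih =>
    have h1 := ih (fun U hU => hW U (by simp [hU])) (α ++ [V]) (by simpa using h)
    have h2 := SwapStep.mk (G := G) α W V (β ++ γ) (hW V (by simp))
    exact .swap (by simpa using h2) (by simpa using h1)

end PCGrammar

lemma List.exists_eq_append_cons_forall_not {A : Type*} (p : A → Prop) {l : List A}
    (h : ∃ x ∈ l, p x) : ∃ l₁ x l₂, l = l₁ ++ x :: l₂ ∧ p x ∧ ∀ y ∈ l₂, ¬ p y := by
  induction l with
  | nil => simp at h
  | cons x l ih =>
    by_cases hl : ∃ y ∈ l, p y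
    · obtain ⟨l₁, y, l₂, rfl, hy, h₂⟩ := ih hl
      exact ⟨x :: l₁, y, l₂, by simp, hy, h₂⟩
    · push Not at hl
      obtain ⟨y, hy, hpy⟩ := h
      rcases List.mem_cons.1 hy with rfl | hy
      · exact ⟨[], y, l, by simp, hpy, hl⟩
      · exact absurd hpy (hl y hy)

/-- Every word of `L` has `d` as its last letter and nowhere else. -/
def EndMarked {T : Type} (d : T) (L : Language T) : Prop :=
  ∀ x y : List T, x ++ y ∈ L → y ≠ [] → d ∈ y ∧ d ∉ x

namespace PCGrammar

variable {T : Type} {G : PCGrammar T}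

/-- If all completions of a configuration are end-marked, the configuration lies within a single
dependence class. -/
lemma not_indep_of_endMarked (hG : G.TransitiveDep) {d : T} {L : Language T}
    (hL : EndMarked d L) {p : List T} {α β : List G.NT} {X Y : G.NT}
    (hp : ∀ V ∈ α ++ X :: Y :: β, G.Productive V)
    (hα : ∀ u, G.Derives (α ++ X :: Y :: β) u [] → p ++ u ∈ L) : ¬ G.Indep X Y := by
  intro hXY
  generalize hc : α ++ X :: Y :: β = c at *
  have hc0 : c ≠ [] := by simp [← hc]
  obtain ⟨ζ, Z, rfl⟩ : ∃ ζ Z, c = ζ ++ [Z] :=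
    ⟨c.dropLast, c.getLast hc0, (List.dropLast_append_getLast hc0).symm⟩
  have hX : X ∈ ζ ++ [Z] := by simp [← hc]
  have hY : Y ∈ ζ ++ [Z] := by simp [← hc]
  -- Otherwise `X` and `Y` are both dependent on `Z`, hence on each other.
  have key : ∃ W ∈ ζ ++ [Z], G.Indep W Z := by
    by_contra! hcon
    exact hG X Z Y (hcon X hX) (fun h => hcon Y hY (G.indep_symm _ _ h)) hXY
  have key' : ∃ W ∈ ζ, G.Indep W Z := by
    obtain ⟨W, hW, hWZ⟩ := key
    rcases List.mem_append.1 hW with h | h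
    · exact ⟨W, h, hWZ⟩
    · rw [List.mem_singleton.1 h] at hWZ
      exact absurd hWZ (G.indep_irrefl Z)
  -- `W` is the last symbol independent of `Z`; all symbols between them depend on `Z`, so by
  -- transitivity they are independent of `W`, which can therefore move to the end.
  obtain ⟨ζ₁, W, ζ₂, rfl, hWZ, hζ₂⟩ := List.exists_eq_append_cons_forall_not _ key'
  have hWV : ∀ V ∈ ζ₂ ++ [Z], G.Indep W V := by
    intro V hV
    rcases List.mem_append.1 hV with h | h
    · by_contra hD
      exact hG W V Z hD (hζ₂ V h) hWZ
    · rwa [List.mem_singleton.1 h]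
  obtain ⟨u₁, h₁⟩ := exists_derives_of_forall_productive (G := G) (α := ζ₁)
    fun V hV => hp V (by simp [hV])
  obtain ⟨u₂, h₂⟩ := exists_derives_of_forall_productive (G := G) (α := ζ₂)
    fun V hV => hp V (by simp [hV])
  obtain ⟨v, hv⟩ := hp Z (by simp)
  obtain ⟨w, hw⟩ := hp W (by simp)
  -- Two completions from the same four words: `m₁` ends in `v`, forcing `d ∈ v`; `m₂` ends in `w`
  -- and forbids `d` in the earlier `v`.
  have m₁ := hα (u₁ ++ (w ++ (u₂ ++ v))) (by
    simpa using h₁.append_nil (hw.append_nil (h₂.append_nil hv)))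
  have m₂ := hα (u₁ ++ (u₂ ++ (v ++ w))) (by
    have := h₁.append_nil (h₂.append_nil (hv.append_nil hw))
    have := Derives.of_move (γ := []) hWV ζ₁ (by simpa using this)
    simpa using this)
  have e₁ := hL (p ++ u₁ ++ w ++ u₂) v (by simpa using m₁) (hv.ne_nil (by simp))
  have e₂ := hL (p ++ u₁ ++ u₂ ++ v) w (by simpa using m₂) (hw.ne_nil (by simp))
  exact e₂.2 (by simp [e₁.1])

/-- Derivations to the empty configuration without swap steps: leftmost derivations of the
underlying context-free grammar. -/
inductive LeftDerives (G : PCGrammar T) : List G.NT → List T → Prop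
  | nil : LeftDerives G [] []
  | cons {X : G.NT} {a : T} {α β : List G.NT} {w : List T} :
      (X, a, α) ∈ G.prods → LeftDerives G (α ++ β) w → LeftDerives G (X :: β) (a :: w)

lemma LeftDerives.derives {α : List G.NT} {w : List T} (h : G.LeftDerives α w) :
    G.Derives α w [] := by
  induction h with
  | nil => exact .nil _
  | cons hp _ ih => exact .prod (.mk _ _ _ _ hp) ih

/-- The prefix `p` records the letters already read, so the hypothesis on completions survives each
production step. -/
lemma Derives.leftDerives (hG : G.TransitiveDep) {d : T} {L : Language T} (hL : EndMarked d L)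
    {α : List G.NT} {w p : List T} (h : G.Derives α w [])
    (hα : ∀ u, G.Derives α u [] → p ++ u ∈ L) : G.LeftDerives α w := by
  generalize hβ : ([] : List G.NT) = β at h
  induction h generalizing p with
  | nil => subst hβ; exact .nil
  | @prod _ _ _ a _ hs _ ih =>
    subst hβ
    have := @ih (p ++ [a]) (fun u hu => by simpa using hα _ (.prod hs hu)) rfl
    obtain ⟨X, a, α, β, hp⟩ := hs
    exact .cons hp this
  | swap hs h ih =>
    subst hβ
    have hprod := (Derives.swap hs h).productive rfl
    obtain ⟨α, X, Y, β, hI⟩ := hs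
    exact absurd hI (not_indep_of_endMarked hG hL hprod hα)

/-! ### Long factors in leftmost derivations -/

lemma LeftDerives.append {α β : List G.NT} {u v : List T} (hu : G.LeftDerives α u)
    (hv : G.LeftDerives β v) : G.LeftDerives (α ++ β) (u ++ v) := by
  induction hu with
  | nil => exact hv
  | cons hp _ ih => exact .cons hp (by simpa using ih)

lemma LeftDerives.split {α β : List G.NT} {w : List T} (h : G.LeftDerives (α ++ β) w) :
    ∃ u v, w = u ++ v ∧ G.LeftDerives α u ∧ G.LeftDerives β v := by
  generalize hγ : α ++ β = γ at h
  induction h generalizing α with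
  | nil =>
    obtain ⟨rfl, rfl⟩ := List.append_eq_nil_iff.1 hγ
    exact ⟨[], [], rfl, .nil, .nil⟩
  | @cons X a δ ζ w hp h ih =>
    rcases α with _ | ⟨Y, α⟩
    · simp only [List.nil_append] at hγ
      subst hγ
      exact ⟨[], a :: w, rfl, .nil, .cons hp h⟩
    · simp only [List.cons_append, List.cons.injEq] at hγ
      obtain ⟨rfl, rfl⟩ := hγ
      obtain ⟨u, v, rfl, hu, hv⟩ := ih (α := δ ++ α) (by simp)
      exact ⟨a :: u, v, rfl, .cons hp hu, hv⟩

/-- A configuration deriving a long word has a symbol deriving a long factor of it. -/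
lemma LeftDerives.exists_long_factor {α : List G.NT} {w : List T} {B : ℕ}
    (h : G.LeftDerives α w) (hw : B * α.length < w.length) :
    ∃ Y p u s, w = p ++ u ++ s ∧ B < u.length ∧ G.LeftDerives [Y] u ∧
      ∀ v, G.LeftDerives [Y] v → G.LeftDerives α (p ++ v ++ s) := by
  induction α generalizing w with
  | nil => cases h; simp at hw
  | cons X α ih =>
    obtain ⟨u, v, rfl, hu, hv⟩ := LeftDerives.split (α := [X]) h
    by_cases hB : B < u.length
    · exact ⟨X, [], u, v, by simp, hB, hu, fun v' hv' => by simpa using hv'.append hv⟩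
    · obtain ⟨Y, p, u', s, rfl, h1, h2, h3⟩ := ih hv (by
        simp only [List.length_cons, List.length_append, mul_add, mul_one] at hw
        omega)
      exact ⟨Y, u ++ p, u', s, by simp, h1, h2,
        fun v' hv' => by simpa using hu.append (h3 v' hv')⟩

/-- Walking down a derivation tree reaches a factor of intermediate length. -/
lemma LeftDerives.exists_factor {m B : ℕ} (hm : ∀ q ∈ G.prods, q.2.2.length ≤ m) {X : G.NT}
    {w : List T} (h : G.LeftDerives [X] w) (hw : B < w.length) :
    ∃ Y p u s, w = p ++ u ++ s ∧ B < u.length ∧ u.length ≤ B * m + 1 ∧ G.LeftDerives [Y] u ∧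
      ∀ v, G.LeftDerives [Y] v → G.LeftDerives [X] (p ++ v ++ s) := by
  induction hn : w.length using Nat.strong_induction_on generalizing X w with
  | _ n ih =>
    by_cases hle : w.length ≤ B * m + 1
    · exact ⟨X, [], w, [], by simp, hw, hle, h, fun v hv => by simpa using hv⟩
    · rcases h with _ | ⟨hp, hα⟩
      rename_i a α w
      simp only [List.append_nil] at hα
      simp only [List.length_cons, not_le] at hle hn
      -- The `+ 1` in the length bound pays for the letter `a` emitted at the root.
      have : B * α.length ≤ B * m := Nat.mul_le_mul_left _ (hm _ hp)
      obtain ⟨Y, p, u, s, rfl, h1, h2, h3⟩ := hα.exists_long_factor (B := B) (by omega)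
      simp only [List.length_append] at hn
      obtain ⟨Z, p', u', s', rfl, g1, g2, g3, g4⟩ := ih u.length (by omega) h2 h1 rfl
      refine ⟨Z, a :: p ++ p', u', s' ++ s, by simp, g1, g2, g3, fun v hv => ?_⟩
      exact .cons hp (by simpa using h3 _ (g4 v hv))

end PCGrammar

/-! ### The concatenation is not in the class -/

lemma count_eq_of_mem_langABC_mul_d {w : List Letter}
    (h : w ∈ langABC * ({[Letter.d]} : Language Letter)) :
    w.count Letter.a = w.count Letter.b ∧ w.count Letter.a = w.count Letter.c ∧
      w.count Letter.d = 1 := by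
  obtain ⟨u, ⟨h1, h2, h3, h4⟩, v, hv, rfl⟩ := Language.mem_mul.1 h
  rw [Set.mem_singleton_iff.1 hv]
  simp [h1, h2, h4]

lemma endMarked_langABC_mul_d :
    EndMarked Letter.d (langABC * ({[Letter.d]} : Language Letter)) := by
  intro x y h hy
  have hc := (count_eq_of_mem_langABC_mul_d h).2.2
  obtain ⟨u, -, v, hv, he⟩ := Language.mem_mul.1 h
  rw [Set.mem_singleton_iff.1 hv] at he
  have hd : Letter.d ∈ y := by
    have h1 : (x ++ y).getLast? = some Letter.d := by rw [← he]; simp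
    rw [List.getLast?_append_of_ne_nil _ hy] at h1
    exact List.mem_of_getLast? h1
  refine ⟨hd, fun hx => ?_⟩
  rw [List.count_append] at hc
  have := List.count_pos_iff.2 hd
  have := List.count_pos_iff.2 hx
  omega

lemma Letter.length_eq_sum_count (w : List Letter) :
    w.length = w.count .a + w.count .b + w.count .c + w.count .d := by
  induction w with
  | nil => rfl
  | cons x w ih => cases x <;> simp <;> omega

/-- A short factor of `aⁿ bⁿ cⁿ d` avoids `a` or `c`. -/
lemma count_eq_zero_of_short_factor {n : ℕ} {p u s : List Letter}
    (h : List.replicate n Letter.a ++ List.replicate n Letter.b ++ List.replicate n Letter.c ++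
      [Letter.d] = p ++ u ++ s) (hu : u.length ≤ n) :
    u.count Letter.a = 0 ∨ u.count Letter.c = 0 := by
  -- Either `u` starts after the block of `a`s, or it ends within the first `2 * n` letters, before
  -- any `c`.
  rcases le_total n p.length with hp | hp
  · left
    have h1 := congrArg (List.drop n) h
    rw [List.append_assoc, List.append_assoc, List.drop_left' (by simp), List.append_assoc p,
      List.drop_append_of_le_length hp] at h1
    have h2 := congrArg (List.count Letter.a) h1
    simp only [List.count_append] at h2
    simp [List.count_replicate] at h2
    omega
  · right
    have h1 := congrArg (List.take (2 * n)) h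
    rw [List.append_assoc (_ ++ _), List.take_left' (by simp; omega),
      List.take_append, List.take_of_length_le (by simp; omega)] at h1
    have h2 := congrArg (List.count Letter.c) h1
    simp only [List.count_append] at h2
    simp [List.count_replicate] at h2
    omega

lemma not_isTrPCCFL_langABC_mul_d :
    ¬ IsTrPCCFL (langABC * ({[Letter.d]} : Language Letter)) := by
  rintro ⟨G, hG, hL⟩
  have := G.finite_NT
  obtain ⟨m, hm⟩ := (G.finite_prods.image fun q => q.2.2.length).bddAbove
  have hm : ∀ q ∈ G.prods, q.2.2.length ≤ m := fun q hq => hm ⟨q, hq, rfl⟩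
  have hC : ∃ C, ∀ Y, (∃ v, G.LeftDerives [Y] v) → ∃ v, G.LeftDerives [Y] v ∧ v.length ≤ C := by
    have h1 : ∀ Y, ∃ C, (∃ v, G.LeftDerives [Y] v) →
        ∃ v, G.LeftDerives [Y] v ∧ v.length ≤ C := fun Y => by
      by_cases h : ∃ v, G.LeftDerives [Y] v
      · obtain ⟨v, hv⟩ := h
        exact ⟨v.length, fun _ => ⟨v, hv, le_rfl⟩⟩
      · exact ⟨0, fun h' => absurd h' h⟩
    choose f hf using h1
    obtain ⟨C, hC⟩ := (Set.finite_range f).bddAbove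
    refine ⟨C, fun Y hY => ?_⟩
    obtain ⟨v, hv, hle⟩ := hf Y hY
    exact ⟨v, hv, hle.trans (hC ⟨Y, rfl⟩)⟩
  obtain ⟨C, hC⟩ := hC
  have hleft : ∀ w, w ∈ langABC * ({[Letter.d]} : Language Letter) →
      G.LeftDerives [G.initial] w := fun w hw => by
    rw [← hL] at hw
    exact PCGrammar.Derives.leftDerives (p := []) hG endMarked_langABC_mul_d hw
      fun u hu => hL ▸ hu
  have hmem : ∀ w, G.LeftDerives [G.initial] w →
      w ∈ langABC * ({[Letter.d]} : Language Letter) := fun w hw => hL ▸ hw.derives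
  -- Large enough that the factor found below has length at most `n`.
  set n := (3 * C + 1) * m + 1 + (3 * C + 1) with hn
  have hw := hleft (List.replicate n Letter.a ++ List.replicate n Letter.b ++
    List.replicate n Letter.c ++ [Letter.d]) (Language.mem_mul.2 ⟨_, by
      refine ⟨?_, ?_, ?_, ?_⟩ <;> simp [List.count_replicate]
      omega, _, rfl, rfl⟩)
  obtain ⟨Y, p, u, s, he, h1, h2, h3, h4⟩ := hw.exists_factor (B := 3 * C + 1) hm (by
    simp; omega)
  obtain ⟨v, hv, hvC⟩ := hC Y ⟨u, h3⟩
  have eu := count_eq_of_mem_langABC_mul_d (hmem _ (h4 u h3))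
  have ev := count_eq_of_mem_langABC_mul_d (hmem _ (h4 v hv))
  have lu := Letter.length_eq_sum_count u
  have lv := Letter.length_eq_sum_count v
  simp only [List.count_append] at eu ev
  -- `u` and `v` agree on `#a - #b`, `#a - #c` and `#d`. Since `u` lacks `a` or `c`, each of its
  -- letter counts is at most that of `v`, so `u.length ≤ C`, contradicting `h1`.
  rcases count_eq_zero_of_short_factor he (by omega) with h | h <;> omega

/-! ### The two factors are in the class -/

/-- The grammar with a single production `X →[x] ε`. -/
abbrev singletonGrammar {T : Type} (x : T) : PCGrammar T where
  NT := Unit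
  finite_NT := inferInstance
  initial := ()
  prods := {((), x, [])}
  finite_prods := Set.finite_singleton _
  Indep _ _ := False
  indep_symm _ _ h := h
  indep_irrefl _ h := h

lemma isTrPCCFL_singleton {T : Type} (x : T) : IsTrPCCFL ({[x]} : Language T) := by
  refine ⟨singletonGrammar x, fun _ _ _ _ _ h => h, ?_⟩
  have key : ∀ α w β, (singletonGrammar x).Derives α w β → β = [] →
      w = List.replicate α.length x := by
    intro α w β h hβ
    induction h with
    | nil => simp [hβ]
    | @prod _ _ _ a _ hs _ ih =>
      obtain ⟨X, _, α, β, hp⟩ := hs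
      obtain ⟨rfl, rfl⟩ : a = x ∧ α = [] := by
        simpa using hp
      simp [ih hβ, List.replicate_succ]
    | swap hs => obtain ⟨_, _, _, _, hI⟩ := hs; exact hI.elim
  ext w
  constructor
  · exact fun hw => key _ _ _ hw rfl
  · intro hw
    rw [Set.mem_singleton_iff.1 hw]
    exact .prod (.mk (G := singletonGrammar x) () x [] [] (Set.mem_singleton _)) (.nil _)

/-- The productions of `grammarABC`. -/
def prodsABC : Set (Letter × Letter × List Letter) :=
  {(.a, .a, []), (.b, .b, []), (.c, .c, []),
    (.d, .a, [.b, .c]), (.d, .b, [.a, .c]), (.d, .c, [.a, .b]),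
    (.d, .a, [.d, .b, .c]), (.d, .b, [.d, .a, .c]), (.d, .c, [.d, .a, .b])}

/-- A commutative grammar for `langABC`: the non-terminals `a`, `b`, `c` each generate the letter of
the same name, and the initial non-terminal `d` opens a new triple of letters. -/
abbrev grammarABC : PCGrammar Letter where
  NT := Letter
  finite_NT := inferInstance
  initial := .d
  prods := prodsABC
  finite_prods := Set.toFinite {_, _, _, _, _, _, _, _, _}
  Indep X Y := X ≠ Y
  indep_symm _ _ h := h.symm
  indep_irrefl _ h := h rfl

namespace grammarABC

lemma derives_of_perm {α β : List Letter} (h : α.Perm β) {w : List Letter} {γ : List Letter}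
    (δ : List Letter) (hβ : grammarABC.Derives (δ ++ β) w γ) :
    grammarABC.Derives (δ ++ α) w γ := by
  induction h generalizing δ with
  | nil => exact hβ
  | cons x _ ih => simpa using ih (δ ++ [x]) (by simpa using hβ)
  | swap x y l =>
    by_cases hxy : y = x
    · subst hxy; exact hβ
    · exact .swap (.mk (G := grammarABC) δ y x l hxy) hβ
  | trans _ _ ih₁ ih₂ => exact ih₁ _ (ih₂ _ hβ)

lemma derives_of_mem {α β w : List Letter} {X x : Letter} (hX : X ∈ α)
    (hp : (X, x, β) ∈ prodsABC)
    (h : grammarABC.Derives (β ++ α.erase X) w []) : grammarABC.Derives α (x :: w) [] :=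
  derives_of_perm (List.perm_cons_erase hX) []
    (.prod (PCGrammar.ProdStep.mk (G := grammarABC) X x β (α.erase X) hp) h)

/-- `m` is the number of productions of `d` used; each `d` present needs at least one. -/
lemma counts_of_derives {α β : List grammarABC.NT} {w : List Letter} (h : grammarABC.Derives α w β) (hβ : β = []) :
    w.count .d = 0 ∧ ∃ m, w.count .a = α.count .a + m ∧ w.count .b = α.count .b + m ∧
      w.count .c = α.count .c + m ∧ α.count .d ≤ m := by
  induction h with
  | nil => subst hβ; exact ⟨rfl, 0, by simp⟩
  | @prod _ _ _ x _ hs _ ih =>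
    obtain ⟨X, _, α, β, hp⟩ := hs
    obtain ⟨h0, m, h1, h2, h3, h4⟩ := ih hβ
    have hp : (X = .a ∧ x = .a ∧ α = []) ∨ (X = .b ∧ x = .b ∧ α = []) ∨
        (X = .c ∧ x = .c ∧ α = []) ∨ (X = .d ∧ x = .a ∧ α = [.b, .c]) ∨
        (X = .d ∧ x = .b ∧ α = [.a, .c]) ∨ (X = .d ∧ x = .c ∧ α = [.a, .b]) ∨
        (X = .d ∧ x = .a ∧ α = [.d, .b, .c]) ∨ (X = .d ∧ x = .b ∧ α = [.d, .a, .c]) ∨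
        (X = .d ∧ x = .c ∧ α = [.d, .a, .b]) := by
      simpa [prodsABC] using hp
    rcases hp with ⟨rfl, rfl, rfl⟩ | ⟨rfl, rfl, rfl⟩ | ⟨rfl, rfl, rfl⟩ | ⟨rfl, rfl, rfl⟩ |
      ⟨rfl, rfl, rfl⟩ | ⟨rfl, rfl, rfl⟩ | ⟨rfl, rfl, rfl⟩ | ⟨rfl, rfl, rfl⟩ | ⟨rfl, rfl, rfl⟩
    iterate 3 refine ⟨by simpa using h0, m, ?_⟩; simp at *; omega
    all_goals refine ⟨by simpa using h0, m + 1, ?_⟩; simp at *; omega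
  | swap hs _ ih =>
    obtain ⟨α, X, Y, β, hI⟩ := hs
    have hperm : (α ++ X :: Y :: β).Perm (α ++ Y :: X :: β) :=
      (List.Perm.swap Y X β).append_left α
    have := ih hβ
    rwa [← hperm.count_eq, ← hperm.count_eq, ← hperm.count_eq, ← hperm.count_eq] at this

/-- Greedy parsing: consume the next letter if its symbol is pending, otherwise open a triple with
it. `m` counts the triples still to open, and a single `d` is kept exactly while `m` is positive. -/
lemma derives_of_counts {α w : List Letter} {m : ℕ} (h0 : w.count .d = 0)
    (ha : w.count .a = α.count .a + m) (hb : w.count .b = α.count .b + m)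
    (hc : w.count .c = α.count .c + m) (hd : α.count .d = min m 1) :
    grammarABC.Derives α w [] := by
  induction w generalizing α m with
  | nil =>
    have : α = [] := by
      rw [← List.length_eq_zero_iff, Letter.length_eq_sum_count α]
      simp at *
      omega
    subst this
    exact .nil _
  | cons x w ih =>
    by_cases hx : x ∈ α
    · have hx' := List.count_pos_iff.2 hx
      rcases x
      case d => simp at h0
      all_goals
        refine derives_of_mem hx (β := []) (by simp [prodsABC]) (ih (m := m) ?_ ?_ ?_ ?_ ?_)
        all_goals
          simp at h0 ha hb hc ⊢
          omega
    · have hx' := List.count_eq_zero.2 hx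
      rcases m with _ | _ | m
      -- With no triple left to open, `x` would have to be pending.
      · cases x <;> simp at * <;> omega
      · have hm : Letter.d ∈ α := List.count_pos_iff.1 (by rw [hd]; simp)
        rcases x
        case d => simp at h0
        case a =>
          refine derives_of_mem hm (β := [.b, .c]) (by simp [prodsABC]) (ih (m := 0) ?_ ?_ ?_ ?_ ?_)
          all_goals simp at *; omega
        case b =>
          refine derives_of_mem hm (β := [.a, .c]) (by simp [prodsABC]) (ih (m := 0) ?_ ?_ ?_ ?_ ?_)
          all_goals simp at *; omega
        case c =>
          refine derives_of_mem hm (β := [.a, .b]) (by simp [prodsABC]) (ih (m := 0) ?_ ?_ ?_ ?_ ?_)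
          all_goals simp at *; omega
      · have hm : Letter.d ∈ α := List.count_pos_iff.1 (by rw [hd]; simp)
        rcases x
        case d => simp at h0
        case a =>
          refine derives_of_mem hm (β := [.d, .b, .c]) (by simp [prodsABC])
            (ih (m := m + 1) ?_ ?_ ?_ ?_ ?_)
          all_goals simp at *; omega
        case b =>
          refine derives_of_mem hm (β := [.d, .a, .c]) (by simp [prodsABC])
            (ih (m := m + 1) ?_ ?_ ?_ ?_ ?_)
          all_goals simp at *; omega
        case c =>
          refine derives_of_mem hm (β := [.d, .a, .b]) (by simp [prodsABC])
            (ih (m := m + 1) ?_ ?_ ?_ ?_ ?_)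
          all_goals simp at *; omega

end grammarABC

lemma isTrPCCFL_langABC : IsTrPCCFL langABC := by
  refine ⟨grammarABC, fun X Y Z h h' => ?_, ?_⟩
  -- Dependence here is equality.
  · rw [not_not.1 h]
    exact h'
  ext w
  constructor
  · intro hw
    obtain ⟨h0, m, h1, h2, h3, h4⟩ := grammarABC.counts_of_derives (α := [Letter.d]) hw rfl
    simp at h1 h2 h3 h4
    refine ⟨?_, ?_, ?_, h0⟩ <;> omega
  · rintro ⟨h1, h2, h3, h4⟩
    refine grammarABC.derives_of_counts (m := w.count Letter.a) h4 ?_ ?_ ?_ (min_eq_right h3).symm <;>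
      simp <;> omega

theorem mainTheorem10 :
    (¬ ∀ (T : Type) [Finite T] (L K : Language T),
      IsTrPCCFL L → IsTrPCCFL K → IsTrPCCFL (L * K)) ∧
    IsTrPCCFL langABC ∧
    IsTrPCCFL ({[Letter.d]} : Language Letter) ∧
    ¬ IsTrPCCFL (langABC * ({[Letter.d]} : Language Letter)) :=
  ⟨fun h => not_isTrPCCFL_langABC_mul_d
      (h Letter _ _ isTrPCCFL_langABC (isTrPCCFL_singleton Letter.d)),
    isTrPCCFL_langABC, isTrPCCFL_singleton Letter.d, not_isTrPCCFL_langABC_mul_d⟩
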